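/- Let $(X,d)$ be a complete metric space; $B(x,s)$ denotes the open ball with centre $x$ and radius $s$, and $\overline{A}$ and $A^{\circ}$ denote the closure and the interior of $A\subset X$. Assume that $X$ is doubling, i.e. there is $N\in\mathbb N$ such that for all $x\in X$ and $s>0$ the ball $B(x,2s)$ is covered by $N$ balls of radius $s$; and that $X$ is uniformly perfect, i.e. there is $\gamma>1$ such that $B(x,\gamma s)\setminus B(x,s)\neq\emptyset$ whenever $x\in X$, $s>0$ and $B(x,s)\neq X$. Let $0<c_*<C_*<\infty$. Then there are constants $C_1,C_2,C_3,r_0>0$ with the following property. Let $r\in(0,r_0]$, and for every $k\in\mathbb Z$ let $\{x_\omega\}_{\omega\in\Omega_k}$ be a family of points of $X$ (the index sets $\Omega_k$ being regarded as disjoint) such that for all $k\in\mathbb Z$ $$d(x_\omega,x_\lambda)\ge c_*r^k\quad\text{for all }\omega,\lambda\in\Omega_k\text{ with }\omega\ne\lambda,$$ $$\text{for every }y\in X\text{ there is }\omega\in\Omega_k\text{ with }d(y,x_\omega)<C_*r^k.$$ Then there are sets $Q_\omega\subset X$ ($k\in\mathbb Z$, $\omega\in\Omega_k$) such that 1. $\bigcup_{\omega\in\Omega_k}Q_\omega=X$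 for every $k\in\mathbb Z$; 2. $(Q_\omega)^{\circ}=(\overline{Q_\omega})^{\circ}$ and $\overline{(Q_\omega)^{\circ}}=\overline{Q_\omega}$ for every $k\in\mathbb Z$ and $\omega\in\Omega_k$; 3. if $l\ge k$, $\omega\in\Omega_l$ and $\lambda\in\Omega_k$, then $Q_\omega\subset Q_\lambda$ or $Q_\omega\cap Q_\lambda=\emptyset$; 4. $B(x_\omega,C_1r^k)\subset Q_\omega\subset B(x_\omega,C_2r^k)$ for every $k\in\mathbb Z$ and $\omega\in\Omega_k$; 5. if $k\in\mathbb Z$ and $y,z\in X$ satisfy $d(y,z)\le C_3r^k$, then there are $\omega_0,\omega_1,\omega_2\in\Omega_k$ with $y\in\overline{Q_{\omega_0}}$, $z\in\overline{Q_{\omega_2}}$, $\overline{Q_{\omega_0}}\cap\overline{Q_{\omega_1}}\ne\emptyset$ and $\overline{Q_{\omega_1}}\cap\overline{Q_{\omega_2}}\ne\emptyset$. -/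

import Mathlib

/-- A metric space is doubling if, for some fixed `N`, every open ball of radius `2 * r` is covered
by `N` open balls of radius `r`. -/
def IsDoublingSpace (X : Type*) [MetricSpace X] : Prop :=
  ∃ N : ℕ, ∀ (x : X) (r : ℝ), 0 < r →
    ∃ c : Fin N → X, Metric.ball x (2 * r) ⊆ ⋃ i, Metric.ball (c i) r

/-- A metric space is uniformly perfect if there is `γ > 1` such that the annulus
`B(x, γ r) \ B(x, r)` is non-empty for every `r > 0` with `B(x, r) ≠ X`. -/
def IsUniformlyPerfectSpace (X : Type*) [MetricSpace X] : Prop :=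
  ∃ γ : ℝ, 1 < γ ∧ ∀ (x : X) (r : ℝ), 0 < r → Metric.ball x r ≠ Set.univ →
    (Metric.ball x (γ * r) \ Metric.ball x r).Nonempty

/-! Cubes come from parent maps between consecutive levels. Each point of `X` gets a thread: indices
compatible with the parent maps, with centres within a multiple of `r ^ k` (`exists_thread`, by
compactness). A cube is the set of points whose thread passes through its index, so covering and
nesting are automatic. The work is to make cubes of neighbouring centres touch, although `X` may be
disconnected. `exists_parent` sends a fine point to a nearby centre, except that for neighbours `ω`,
`v` two close fine points near `ω` are taken (uniform perfectness) and one is given to `v`. Doubling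
bounds the number of neighbours, so each has its own annulus about `ω`; the exceptions neither clash
nor come too close to `ω`. Neighbours then have neighbouring children, and iterating gives, by
completeness, a point in both closures (`closure_threadCube_inter_nonempty`). Regularity holds
because each point of a cube is a limit of finer centres lying in its open core
(`threadCube_subset_closure_familyCore`). -/

open Metric Set Filter Topology

/-! ### Counting separated points in doubling spaces -/

/-- In a doubling space, a ball of radius `2 ^ n * r` is covered by a bounded number of balls of
radius `r`. -/
theorem IsDoublingSpace.exists_cover_pow {X : Type*} [MetricSpace X] (h : IsDoublingSpace X)
    (n : ℕ) : ∃ K : ℕ, ∀ (p : X) (r : ℝ), 0 < r →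
      ∃ e : Fin K → X, ball p (2 ^ n * r) ⊆ ⋃ i, ball (e i) r := by
  obtain ⟨N, hN⟩ := h
  induction n with
  | zero => exact ⟨1, fun p r _ => ⟨fun _ => p, by simp [iUnion_const]⟩⟩
  | succ n ih =>
    obtain ⟨K, hK⟩ := ih
    refine ⟨K * N, fun p r hr => ?_⟩
    obtain ⟨e, he⟩ := hK p (2 * r) (by positivity)
    choose g hg using fun q => hN q r hr
    refine ⟨fun i => g (e (finProdFinEquiv.symm i).1) (finProdFinEquiv.symm i).2, fun y hy => ?_⟩
    have hy' : y ∈ ball p (2 ^ n * (2 * r)) := by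
      rwa [← mul_assoc, ← pow_succ]
    obtain ⟨i, hi⟩ := mem_iUnion.1 (he hy')
    obtain ⟨j, hj⟩ := mem_iUnion.1 (hg _ hi)
    exact mem_iUnion.2 ⟨finProdFinEquiv (i, j), by simpa using hj⟩

/-- In a doubling space, the points of a `c * s`-separated family that lie in a ball of radius
`R * s` can be numbered by boundedly many naturals, uniformly in `s`. -/
theorem IsDoublingSpace.exists_numbering.{u, v} {X : Type u} [MetricSpace X]
    (h : IsDoublingSpace X) {c : ℝ} (hc : 0 < c) (R : ℝ) :
    ∃ M : ℕ, ∀ (s : ℝ), 0 < s → ∀ (Ω : Type v) (x : Ω → X),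
      (∀ ω v : Ω, ω ≠ v → c * s ≤ dist (x ω) (x v)) → ∀ p : X,
      ∃ j : Ω → ℕ, (∀ v, dist p (x v) ≤ R * s → j v < M) ∧
        InjOn j {v | dist p (x v) ≤ R * s} := by
  obtain ⟨n, hn⟩ := pow_unbounded_of_one_lt (2 * R / c) (one_lt_two : (1 : ℝ) < 2)
  obtain ⟨M, hM⟩ := h.exists_cover_pow n
  refine ⟨M, fun s hs Ω x hsep p => ?_⟩
  obtain ⟨e, he⟩ := hM p (c * s / 2) (by positivity)
  -- A ball of radius `c * s / 2` holds at most one point of the family, so the index of a covering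
  -- ball can number the point.
  have key : ∀ v, ∃ i : ℕ, dist p (x v) ≤ R * s →
      ∃ hi : i < M, dist (x v) (e ⟨i, hi⟩) < c * s / 2 := by
    intro v
    by_cases hv : dist p (x v) ≤ R * s
    · have hmem : x v ∈ ball p (2 ^ n * (c * s / 2)) := by
        rw [mem_ball, dist_comm]
        rw [div_lt_iff₀ hc] at hn
        nlinarith
      obtain ⟨i, hi⟩ := mem_iUnion.1 (he hmem)
      exact ⟨i, fun _ => ⟨i.2, hi⟩⟩
    · exact ⟨0, fun h => absurd h hv⟩
  choose j hj using key
  refine ⟨j, fun v hv => (hj v hv).1, fun v hv w hw hvw => ?_⟩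
  by_contra hne
  obtain ⟨h1, h2⟩ := hj v hv
  obtain ⟨h3, h4⟩ := hj w hw
  have h5 : (⟨j v, h1⟩ : Fin M) = ⟨j w, h3⟩ := Fin.ext hvw
  rw [h5] at h2
  have := hsep v w hne
  have := dist_triangle_right (x v) (x w) (e ⟨j w, h3⟩)
  linarith

/-! ### Threads by compactness -/

/-- A descending sequence of finite non-empty sets, indexed by the integers and connected by maps
`π k`, admits a compatible family of elements. -/
theorem exists_thread {Ω : ℤ → Type*} (π : ∀ k, Ω (k + 1) → Ω k) (E : ∀ k, Set (Ω k))
    (hfin : ∀ k, (E k).Finite) (hne : ∀ k, (E k).Nonempty)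
    (hmap : ∀ k, MapsTo (π k) (E (k + 1)) (E k)) :
    ∃ f : ∀ k, Ω k, (∀ k, f k ∈ E k) ∧ ∀ k, π k (f (k + 1)) = f k := by
  let _ : ∀ k, TopologicalSpace (Ω k) := fun _ => ⊥
  have : ∀ k, DiscreteTopology (Ω k) := fun _ => ⟨rfl⟩
  let Z : ℕ → Set (∀ k, Ω k) := fun n =>
    univ.pi E ∩ ⋂ k : ℤ, ⋂ _ : -(n : ℤ) ≤ k ∧ k < n, {f | π k (f (k + 1)) = f k}
  have hclosed : ∀ n, IsClosed (Z n) := by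
    intro n
    refine (isClosed_set_pi fun k _ => isClosed_discrete _).inter
      (isClosed_iInter fun k => isClosed_iInter fun _ => isClosed_eq ?_ (continuous_apply k))
    exact continuous_of_discreteTopology.comp (continuous_apply (k + 1))
  have hcomp : ∀ n, IsCompact (Z n) := fun n =>
    (isCompact_univ_pi fun k => (hfin k).isCompact).of_isClosed_subset (hclosed n) inter_subset_left
  -- Arbitrary choices become compatible on a finite window by pushing the top entry down through
  -- `π`.
  have hdesc : ∀ (n : ℤ) (j : ℕ), ∃ f : ∀ k, Ω k, (∀ k, f k ∈ E k) ∧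
      ∀ k, n - j ≤ k → k < n → π k (f (k + 1)) = f k := by
    intro n j
    induction j with
    | zero =>
      choose f hf using hne
      exact ⟨f, hf, fun k h1 h2 => by simp at h1; omega⟩
    | succ j ih =>
      obtain ⟨f, hf, hπ⟩ := ih
      refine ⟨Function.update f (n - (j + 1)) (π _ (f (n - (j + 1) + 1))), fun k => ?_,
        fun k h1 h2 => ?_⟩
      · by_cases hk : k = n - (j + 1)
        · subst hk
          simpa using hmap _ (hf _)
        · simpa [Function.update_of_ne hk] using hf k
      · push_cast at h1
        by_cases hk : k = n - (j + 1)
        · subst hk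
          rw [Function.update_self, Function.update_of_ne (by omega)]
        · rw [Function.update_of_ne hk, Function.update_of_ne (by omega)]
          exact hπ k (by omega) h2
  have hnonempty : ∀ n, (Z n).Nonempty := by
    intro n
    obtain ⟨f, hf, hπ⟩ := hdesc n (2 * n)
    refine ⟨f, fun k _ => hf k, ?_⟩
    simp only [mem_iInter, mem_ofPred_eq]
    exact fun k hk => hπ k (by push_cast; omega) hk.2
  have hanti : ∀ n, Z (n + 1) ⊆ Z n := by
    intro n f hf
    refine ⟨hf.1, ?_⟩
    have := hf.2
    simp only [mem_iInter, mem_ofPred_eq] at this ⊢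
    exact fun k hk => this k ⟨by push_cast; omega, by push_cast; omega⟩
  obtain ⟨f, hf⟩ := IsCompact.nonempty_iInter_of_sequence_nonempty_isCompact_isClosed Z hanti
    hnonempty (hcomp 0) hclosed
  rw [mem_iInter] at hf
  refine ⟨f, fun k => (hf 0).1 k (mem_univ k), fun k => ?_⟩
  have := (hf (k.natAbs + 1)).2
  simp only [mem_iInter, mem_ofPred_eq] at this
  exact this k ⟨by omega, by omega⟩

/-! ### Separated annuli -/

/-- Radii decreasing geometrically, so that the annuli `t ≤ d < γ * t` are well separated. -/
noncomputable def annulusRadius (c γ : ℝ) (j : ℕ) : ℝ := c / (8 * γ) * (1 / (2 * γ)) ^ j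

section annulusRadius

variable {c γ : ℝ}

theorem annulusRadius_pos (hc : 0 < c) (hγ : 1 < γ) (j : ℕ) : 0 < annulusRadius c γ j := by
  unfold annulusRadius
  positivity

theorem annulusRadius_mul (s : ℝ) (j : ℕ) :
    annulusRadius (c * s) γ j = annulusRadius c γ j * s := by
  unfold annulusRadius
  ring

theorem annulusRadius_anti (hc : 0 < c) (hγ : 1 < γ) {i j : ℕ} (hij : i ≤ j) :
    annulusRadius c γ j ≤ annulusRadius c γ i := by
  unfold annulusRadius
  have : 1 / (2 * γ) ≤ 1 := by
    rw [div_le_one (by linarith)]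
    linarith
  gcongr ?_ * ?_
  exact pow_le_pow_of_le_one (by positivity) this hij

/-- Even the outermost annulus, enlarged by `9 / 8`, stays within `c / 4` of its centre, so annuli
about different centres of a `c`-separated family are disjoint. -/
theorem mul_annulusRadius_le (hc : 0 < c) (hγ : 1 < γ) (j : ℕ) :
    γ * annulusRadius c γ j ≤ c / 8 := by
  have h := annulusRadius_anti hc hγ (Nat.zero_le j)
  have h0 : γ * annulusRadius c γ 0 = c / 8 := by
    unfold annulusRadius
    field_simp
  nlinarith

theorem annulusRadius_le (hc : 0 < c) (hγ : 1 < γ) (j : ℕ) : annulusRadius c γ j ≤ c / 8 := by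
  have := mul_annulusRadius_le hc hγ j
  have := annulusRadius_pos hc hγ j
  nlinarith

theorem mul_annulusRadius_le_of_lt (hc : 0 < c) (hγ : 1 < γ) {i j : ℕ} (hij : i < j) :
    γ * annulusRadius c γ j ≤ annulusRadius c γ i / 2 := by
  have h := annulusRadius_anti hc hγ (Nat.succ_le_of_lt hij)
  have h0 : γ * annulusRadius c γ (i + 1) = annulusRadius c γ i / 2 := by
    unfold annulusRadius
    rw [pow_succ]
    field_simp
  rw [← h0]
  exact mul_le_mul_of_nonneg_left h (by linarith)

/-- Slightly enlarged annuli with different indices are disjoint. -/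
theorem annulusRadius_index_unique (hc : 0 < c) (hγ : 1 < γ) {i j : ℕ} {d : ℝ}
    (hi : 7 / 8 * annulusRadius c γ i ≤ d) (hi' : d ≤ 9 / 8 * (γ * annulusRadius c γ i))
    (hj : 7 / 8 * annulusRadius c γ j ≤ d) (hj' : d ≤ 9 / 8 * (γ * annulusRadius c γ j)) :
    i = j := by
  rcases lt_trichotomy i j with h | h | h
  · have := mul_annulusRadius_le_of_lt hc hγ h
    have := annulusRadius_pos hc hγ i
    linarith
  · exact h
  · have := mul_annulusRadius_le_of_lt hc hγ h
    have := annulusRadius_pos hc hγ j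
    linarith

end annulusRadius

/-! ### The parent map -/

section Parent

variable {X Ω Ω' : Type*} [MetricSpace X] {x : Ω → X} {x' : Ω' → X} {γ c C D : ℝ}

/-- Two different points of a dense family lying close to each other and in a prescribed annulus. -/
theorem exists_pair_in_annulus (hγ : 1 < γ)
    (hperf : ∀ (p : X) (r : ℝ), 0 < r → ball p r ≠ univ → (ball p (γ * r) \ ball p r).Nonempty)
    (hD : 0 < D) (hden : ∀ y, ∃ h, dist y (x' h) < D) {p z : X} {t : ℝ} (ht : 0 < t)
    (hDt : (γ + 3) * D ≤ t / 8) (hz : t ≤ dist p z) :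
    ∃ h h' : Ω', h ≠ h' ∧ dist (x' h) (x' h') ≤ (γ + 2) * D ∧
      7 / 8 * t ≤ dist (x' h) p ∧ dist (x' h) p ≤ 9 / 8 * (γ * t) ∧
      7 / 8 * t ≤ dist (x' h') p ∧ dist (x' h') p ≤ 9 / 8 * (γ * t) := by
  have hball : ball p t ≠ univ := fun h => by
    have : z ∈ ball p t := h ▸ mem_univ z
    rw [mem_ball, dist_comm] at this
    linarith
  obtain ⟨q, hq, hq'⟩ := hperf p t ht hball
  rw [mem_ball] at hq hq'
  rw [not_lt] at hq'
  obtain ⟨h, hh⟩ := hden q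
  have hball' : ball (x' h) D ≠ univ := fun he => by
    have : p ∈ ball (x' h) D := he ▸ mem_univ p
    rw [mem_ball] at this
    have := dist_triangle_right q p (x' h)
    nlinarith
  -- Since `w` is at least `D` away from `x' h`, the fine point approximating it is not `h`.
  obtain ⟨w, hw, hw'⟩ := hperf (x' h) D hD hball'
  rw [mem_ball] at hw hw'
  rw [not_lt] at hw'
  obtain ⟨h', hh'⟩ := hden w
  have e1 : dist (x' h) (x' h') ≤ (γ + 1) * D := by
    have := dist_triangle_left (x' h) (x' h') w
    nlinarith
  have e2 := dist_triangle (x' h) q p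
  have e3 := dist_triangle q (x' h) p
  have e4 := dist_triangle (x' h') (x' h) p
  have e5 := dist_triangle (x' h) (x' h') p
  rw [dist_comm (x' h) q] at e2
  rw [dist_comm (x' h') (x' h)] at e4
  have e6 : t ≤ γ * t := by nlinarith
  refine ⟨h, h', ?_, ?_, ?_, ?_, ?_, ?_⟩
  · rintro rfl
    linarith
  all_goals nlinarith

/-- A map sending each point of a family to a nearby point of a separated dense family. -/
theorem exists_nearest (hcC : c < C) (hC : 0 < C)
    (hsep : ∀ ω v : Ω, ω ≠ v → c ≤ dist (x ω) (x v)) (hden : ∀ y, ∃ ω, dist y (x ω) < C) :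
    ∃ δ : X → Ω, ∀ y, dist y (x (δ y)) < C ∧ ∀ ω, dist y (x ω) < c / 2 → δ y = ω := by
  have : ∀ y, ∃ v, dist y (x v) < C ∧ ∀ ω, dist y (x ω) < c / 2 → v = ω := by
    intro y
    by_cases h : ∃ v, dist y (x v) < c / 2
    · obtain ⟨v, hv⟩ := h
      refine ⟨v, by linarith, fun ω hω => ?_⟩
      by_contra hne
      have := hsep v ω hne
      have := dist_triangle_left (x v) (x ω) y
      linarith
    · push Not at h
      obtain ⟨v, hv⟩ := hden y
      exact ⟨v, hv, fun ω hω => absurd hω (not_lt.2 (h ω))⟩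
  choose δ hδ using this
  exact ⟨δ, hδ⟩

/-- The parent map between two consecutive scales: every fine point is sent to a nearby coarse
point in such a way that neighbouring coarse points always have neighbouring children. -/
theorem exists_parent (hγ : 1 < γ)
    (hperf : ∀ (p : X) (r : ℝ), 0 < r → ball p r ≠ univ → (ball p (γ * r) \ ball p r).Nonempty)
    (hc : 0 < c) (hcC : c < C) (hD : 0 < D)
    (hsep : ∀ ω v : Ω, ω ≠ v → c ≤ dist (x ω) (x v)) (hden : ∀ y, ∃ ω, dist y (x ω) < C)
    (hden' : ∀ y, ∃ h, dist y (x' h) < D) {M : ℕ}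
    (hM : ∀ ω, ∃ j : Ω → ℕ, (∀ v, dist (x ω) (x v) ≤ (γ + 2) * C → j v < M) ∧
        InjOn j {v | dist (x ω) (x v) ≤ (γ + 2) * C})
    (hDM : (γ + 3) * D ≤ annulusRadius c γ M / 8) :
    ∃ π : Ω' → Ω, (∀ h, dist (x' h) (x (π h)) ≤ (γ + 3) * C) ∧
      (∀ h ω, dist (x' h) (x ω) ≤ annulusRadius c γ M / 2 → π h = ω) ∧
      (∀ ω v, dist (x ω) (x v) ≤ (γ + 2) * C →
        ∃ h h', π h = ω ∧ π h' = v ∧ dist (x' h) (x' h') ≤ (γ + 2) * D) ∧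
      (∀ h h', dist (x' h) (x' h') ≤ c / 4 →
        ∃ ω, dist (x (π h)) (x ω) ≤ (γ + 2) * C ∧ dist (x ω) (x (π h')) ≤ (γ + 2) * C) := by
  have hC : 0 < C := hc.trans hcC
  obtain ⟨δ, hδ⟩ := exists_nearest hcC hC hsep hden
  choose j hjM hj using hM
  have hpair : ∀ ω v, ∃ h h' : Ω', v ≠ ω → dist (x ω) (x v) ≤ (γ + 2) * C →
      h ≠ h' ∧ dist (x' h) (x' h') ≤ (γ + 2) * D ∧
      7 / 8 * annulusRadius c γ (j ω v) ≤ dist (x' h) (x ω) ∧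
      dist (x' h) (x ω) ≤ 9 / 8 * (γ * annulusRadius c γ (j ω v)) ∧
      7 / 8 * annulusRadius c γ (j ω v) ≤ dist (x' h') (x ω) ∧
      dist (x' h') (x ω) ≤ 9 / 8 * (γ * annulusRadius c γ (j ω v)) := by
    intro ω v
    by_cases hv : v ≠ ω ∧ dist (x ω) (x v) ≤ (γ + 2) * C
    · have h1 := hsep ω v hv.1.symm
      have h2 := annulusRadius_anti hc hγ (hjM ω v hv.2).le
      have h3 := annulusRadius_le hc hγ (j ω v)
      obtain ⟨h, h', hh⟩ := exists_pair_in_annulus hγ hperf hD hden' (p := x ω) (z := x v)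
        (annulusRadius_pos hc hγ (j ω v)) (by linarith) (by linarith)
      exact ⟨h, h', fun _ _ => hh⟩
    · obtain ⟨h, -⟩ := hden' (x ω)
      exact ⟨h, h, fun h1 h2 => absurd ⟨h1, h2⟩ hv⟩
  -- `sp ω v` will be given to `v`, while `sp' ω v` stays with `ω`.
  choose sp sp' hsp using hpair
  have hclose : ∀ {y : X} {ω v : Ω}, dist y (x ω) < c / 2 → dist y (x v) < c / 2 → ω = v :=
    fun {y ω v} h1 h2 => ((hδ y).2 ω h1).symm.trans ((hδ y).2 v h2)
  have hsmall : ∀ {d : ℝ} {i : ℕ}, d ≤ 9 / 8 * (γ * annulusRadius c γ i) → d < c / 4 := by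
    intro d i hd
    have := mul_annulusRadius_le hc hγ i
    linarith
  have hnear : ∀ ω v, v ≠ ω → dist (x ω) (x v) ≤ (γ + 2) * C →
      dist (x' (sp ω v)) (x ω) < c / 4 := fun ω v h1 h2 => hsmall (hsp ω v h1 h2).2.2.2.1
  -- The point determines `ω` by proximity and then `v` by its annulus.
  have huniq : ∀ ω v ω₁ v₁, v ≠ ω → dist (x ω) (x v) ≤ (γ + 2) * C →
      v₁ ≠ ω₁ → dist (x ω₁) (x v₁) ≤ (γ + 2) * C → sp ω v = sp ω₁ v₁ → v = v₁ := by
    intro ω v ω₁ v₁ h1 h2 h3 h4 he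
    have e1 := hnear ω v h1 h2
    have e2 := hnear ω₁ v₁ h3 h4
    rw [← he] at e2
    obtain rfl : ω = ω₁ := hclose (y := x' (sp ω v)) (by linarith) (by linarith)
    obtain ⟨-, -, a1, a2, -, -⟩ := hsp ω v h1 h2
    obtain ⟨-, -, b1, b2, -, -⟩ := hsp ω v₁ h3 h4
    rw [← he] at b1 b2
    exact hj ω h2 h4 (annulusRadius_index_unique hc hγ a1 a2 b1 b2)
  have hπ : ∀ h, ∃ w, (∀ ω v, v ≠ ω → dist (x ω) (x v) ≤ (γ + 2) * C → sp ω v = h → w = v) ∧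
      ((∃ ω v, v ≠ ω ∧ dist (x ω) (x v) ≤ (γ + 2) * C ∧ sp ω v = h) ∨ w = δ (x' h)) := by
    intro h
    by_cases hh : ∃ ω v, v ≠ ω ∧ dist (x ω) (x v) ≤ (γ + 2) * C ∧ sp ω v = h
    · obtain ⟨ω, v, h1, h2, h3⟩ := hh
      exact ⟨v, fun ω₁ v₁ h4 h5 h6 => huniq ω v ω₁ v₁ h1 h2 h4 h5 (h3.trans h6.symm),
        Or.inl ⟨ω, v, h1, h2, h3⟩⟩
    · exact ⟨δ (x' h), fun ω v h1 h2 h3 => absurd ⟨ω, v, h1, h2, h3⟩ hh, Or.inr rfl⟩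
  choose π hπ hπ' using hπ
  -- a fine point is either reassigned to a neighbour of its nearest centre, or has that as parent
  have hcase : ∀ h, (∃ ω, dist (x' h) (x ω) < c / 4 ∧ π h ≠ ω ∧ sp ω (π h) = h ∧
      dist (x ω) (x (π h)) ≤ (γ + 2) * C) ∨ π h = δ (x' h) := by
    intro h
    rcases hπ' h with ⟨ω, v, h1, h2, h3⟩ | h1
    · have hv := hπ h ω v h1 h2 h3
      rw [hv]
      exact Or.inl ⟨ω, by rw [← h3]; exact hnear ω v h1 h2, h1, h3, h2⟩
    · exact Or.inr h1
  have hball : ∀ h ω, dist (x' h) (x ω) ≤ annulusRadius c γ M / 2 → π h = ω := by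
    intro h ω hω
    have ha := annulusRadius_le hc hγ M
    rcases hcase h with ⟨ω₁, h1, h2, h3, h4⟩ | h1
    · obtain rfl : ω = ω₁ := hclose (y := x' h) (by linarith) (by linarith)
      have h5 := (hsp ω (π h) h2 h4).2.2.1
      rw [h3] at h5
      have h6 := annulusRadius_anti hc hγ (hjM ω (π h) h4).le
      have h7 := annulusRadius_pos hc hγ M
      linarith
    · rw [h1]
      exact (hδ _).2 ω (by linarith)
  refine ⟨π, fun h => ?_, hball, fun ω v hωv => ?_, fun h h' hhh => ?_⟩
  · rcases hcase h with ⟨ω, h1, h2, h3, h4⟩ | h1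
    · have := dist_triangle (x' h) (x ω) (x (π h))
      nlinarith
    · rw [h1]
      have := (hδ (x' h)).1
      nlinarith
  · rcases eq_or_ne v ω with rfl | hne
    · obtain ⟨h, hh⟩ := hden' (x v)
      have : π h = v := hball h v (by
        have := annulusRadius_pos hc hγ M
        rw [dist_comm]
        nlinarith)
      exact ⟨h, h, this, this, by rw [dist_self]; positivity⟩
    · obtain ⟨a1, a2, a3, a4, a5, a6⟩ := hsp ω v hne hωv
      refine ⟨sp' ω v, sp ω v, ?_, hπ _ ω v hne hωv rfl, by rwa [dist_comm]⟩
      have hs := hsmall a6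
      -- In this annulus only `sp ω v` is given away, and it differs from `sp' ω v`.
      rcases hcase (sp' ω v) with ⟨ω₁, h1, h2, h3, h4⟩ | h1
      · obtain rfl : ω = ω₁ := hclose (y := x' (sp' ω v)) (by linarith) (by linarith)
        obtain ⟨-, -, b1, b2, -, -⟩ := hsp ω _ h2 h4
        rw [h3] at b1 b2
        have := hj ω hωv h4 (annulusRadius_index_unique hc hγ a5 a6 b1 b2)
        rw [← this] at h3
        exact absurd h3 a1
      · rw [h1]
        exact (hδ _).2 ω (by linarith)
  · have aux : ∀ h h', dist (x' h) (x' h') ≤ c / 4 → (∃ ω, dist (x' h) (x ω) < c / 4 ∧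
        π h ≠ ω ∧ sp ω (π h) = h ∧ dist (x ω) (x (π h)) ≤ (γ + 2) * C) →
        ∃ ω, dist (x (π h)) (x ω) ≤ (γ + 2) * C ∧ dist (x ω) (x (π h')) ≤ (γ + 2) * C := by
      rintro h h' hhh ⟨ω, h1, h2, h3, h4⟩
      refine ⟨ω, by rwa [dist_comm], ?_⟩
      have h5 : dist (x' h') (x ω) < c / 2 := by
        have := dist_triangle_left (x' h') (x ω) (x' h)
        linarith
      rcases hcase h' with ⟨ω₁, k1, k2, k3, k4⟩ | k1
      · obtain rfl : ω = ω₁ := hclose h5 (by linarith)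
        exact k4
      · rw [k1, (hδ _).2 ω h5, dist_self]
        positivity
    rcases hcase h with h1 | h1
    · exact aux h h' hhh h1
    rcases hcase h' with h2 | h2
    · obtain ⟨ω, k1, k2⟩ := aux h' h (by rwa [dist_comm]) h2
      exact ⟨ω, by rwa [dist_comm], by rwa [dist_comm]⟩
    refine ⟨π h, by rw [dist_self]; positivity, ?_⟩
    have k1 := (hδ (x' h)).1
    have k2 := (hδ (x' h')).1
    rw [← h1] at k1
    rw [← h2] at k2
    have k3 := dist_triangle4 (x (π h)) (x' h) (x' h') (x (π h'))
    rw [dist_comm (x (π h)) (x' h)] at k3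
    nlinarith

end Parent

/-! ### Regular locally finite covers -/

section Regularity

variable {X ι : Type*} [TopologicalSpace X] {Q : ι → Set X}

/-- The points that are not in the closure of any other member of the family. -/
def familyCore (Q : ι → Set X) (ω : ι) : Set X := (⋃ v : {v // v ≠ ω}, closure (Q v))ᶜ

theorem mem_familyCore {ω : ι} {p : X} :
    p ∈ familyCore Q ω ↔ ∀ v, v ≠ ω → p ∉ closure (Q v) := by
  simp [familyCore]

theorem isOpen_familyCore (hQ : LocallyFinite Q) (ω : ι) : IsOpen (familyCore Q ω) :=
  ((hQ.closure.comp_injective Subtype.val_injective).isClosed_iUnion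
    fun _ => isClosed_closure).isOpen_compl

theorem familyCore_subset (hcover : ⋃ ω, Q ω = univ) (ω : ι) : familyCore Q ω ⊆ Q ω := by
  intro p hp
  obtain ⟨v, hv⟩ := mem_iUnion.1 (hcover ▸ mem_univ p)
  by_cases h : v = ω
  · exact h ▸ hv
  · exact absurd (subset_closure hv) (mem_familyCore.1 hp v h)

/-- If the core of each member of a locally finite cover is dense in that member, then the members
have regular open interior and regular closed closure. -/
theorem regular_of_subset_closure_familyCore (hQ : LocallyFinite Q) (hcover : ⋃ ω, Q ω = univ)
    (hdense : ∀ ω, Q ω ⊆ closure (familyCore Q ω)) (ω : ι) :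
    interior (Q ω) = interior (closure (Q ω)) ∧ closure (interior (Q ω)) = closure (Q ω) := by
  have h1 : familyCore Q ω ⊆ interior (Q ω) :=
    interior_maximal (familyCore_subset hcover ω) (isOpen_familyCore hQ ω)
  have h2 : interior (closure (Q ω)) ⊆ familyCore Q ω := by
    intro p hp
    rw [mem_familyCore]
    intro v hv hpv
    obtain ⟨q, hq, hq'⟩ := mem_closure_iff.1 (closure_minimal (hdense v) isClosed_closure hpv)
      _ isOpen_interior hp
    exact mem_familyCore.1 hq' ω hv.symm (interior_subset hq)
  refine ⟨(interior_mono subset_closure).antisymm (h2.trans h1),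
    (closure_mono interior_subset).antisymm ?_⟩
  exact closure_minimal ((hdense ω).trans (closure_mono h1)) isClosed_closure

end Regularity

/-! ### Cubes defined by threads -/

section Threads

variable {Ω : ℤ → Type*} {π : ∀ k, Ω (k + 1) → Ω k}

theorem thread_eq_of_le {f g : ∀ k, Ω k} (hf : ∀ k, π k (f (k + 1)) = f k)
    (hg : ∀ k, π k (g (k + 1)) = g k) {k l : ℤ} (hkl : k ≤ l) (h : f l = g l) : f k = g k := by
  induction k, hkl using Int.leInductionDown with
  | base => exact h
  | pred n hn ih =>
    have h1 := hf (n - 1)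
    have h2 := hg (n - 1)
    rw [← h1, ← h2]
    congr 1
    rw [sub_add_cancel]
    exact ih

variable {X : Type*} {f : X → ∀ k, Ω k}

/-- The cube of index `ω`: all points whose thread passes through `ω`. -/
def threadCube (f : X → ∀ k, Ω k) (k : ℤ) (ω : Ω k) : Set X := {p | f p k = ω}

theorem mem_threadCube {k : ℤ} {ω : Ω k} {p : X} : p ∈ threadCube f k ω ↔ f p k = ω := Iff.rfl

theorem iUnion_threadCube (k : ℤ) : ⋃ ω, threadCube f k ω = univ :=
  eq_univ_of_forall fun p => mem_iUnion.2 ⟨f p k, rfl⟩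

theorem threadCube_subset_parent (hf : ∀ p k, π k (f p (k + 1)) = f p k) (k : ℤ)
    (ω : Ω (k + 1)) : threadCube f (k + 1) ω ⊆ threadCube f k (π k ω) := by
  intro p hp
  rw [mem_threadCube] at hp ⊢
  rw [← hf p k, hp]

theorem threadCube_nested (hf : ∀ p k, π k (f p (k + 1)) = f p k) {k l : ℤ} (hkl : k ≤ l)
    (ω : Ω l) (v : Ω k) : threadCube f l ω ⊆ threadCube f k v ∨
      threadCube f l ω ∩ threadCube f k v = ∅ := by
  rw [or_iff_not_imp_right, ← ne_eq, ← nonempty_iff_ne_empty]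
  rintro ⟨p, hp, hp'⟩ q hq
  rw [mem_threadCube] at hp hp' hq ⊢
  rw [← hp']
  exact thread_eq_of_le (hf q) (hf p) hkl (hq.trans hp.symm)

variable [TopologicalSpace X]

/-- By local finiteness the closure of a coarse cube is the union of the closures of its children,
so avoiding all other fine closures forces avoiding all coarse ones except the parent's. -/
theorem familyCore_threadCube_subset_parent (hf : ∀ p k, π k (f p (k + 1)) = f p k)
    (hlf : ∀ k, LocallyFinite (threadCube f k)) (k : ℤ) (ω : Ω (k + 1)) :
    familyCore (threadCube f (k + 1)) ω ⊆ familyCore (threadCube f k) (π k ω) := by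
  intro p hp
  rw [mem_familyCore] at hp ⊢
  intro v hv hpv
  have hsub : threadCube f k v ⊆ ⋃ w : {w // π k w = v}, threadCube f (k + 1) w := fun q hq =>
    mem_iUnion.2 ⟨⟨f q (k + 1), (hf q k).trans hq⟩, rfl⟩
  have hsublf : LocallyFinite fun w : {w // π k w = v} => threadCube f (k + 1) w :=
    (hlf (k + 1)).comp_injective Subtype.val_injective
  have h := closure_mono hsub hpv
  rw [hsublf.closure_iUnion] at h
  obtain ⟨⟨w, hw⟩, hpw⟩ := mem_iUnion.1 h
  refine hp w ?_ hpw
  rintro rfl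
  exact hv hw.symm

theorem familyCore_threadCube_antitone (hf : ∀ p k, π k (f p (k + 1)) = f p k)
    (hlf : ∀ k, LocallyFinite (threadCube f k)) (p : X) {k l : ℤ} (hkl : k ≤ l) :
    familyCore (threadCube f l) (f p l) ⊆ familyCore (threadCube f k) (f p k) := by
  induction l, hkl using Int.leInduction with
  | base => exact Subset.rfl
  | succ n hn ih =>
    refine Subset.trans ?_ ih
    rw [← hf p n]
    exact familyCore_threadCube_subset_parent hf hlf n _

end Threads

/-! ### Touching and regularity of cubes -/

section Cubes

variable {X : Type*} [MetricSpace X] {Ω : ℤ → Type*} {π : ∀ k, Ω (k + 1) → Ω k}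
  {x : ∀ k, Ω k → X} {f : X → ∀ k, Ω k} {r A : ℝ}

/-- Neighbouring cubes touch, if neighbouring indices always have neighbouring children. -/
theorem closure_threadCube_inter_nonempty [CompleteSpace X] (hr : 0 < r) (hr1 : r < 1) {A₀ : ℝ}
    (hf : ∀ p k, π k (f p (k + 1)) = f p k)
    (hmem : ∀ k ω, x k ω ∈ threadCube f k ω)
    (hparent : ∀ k ω, dist (x (k + 1) ω) (x k (π k ω)) ≤ A * r ^ k)
    (hchild : ∀ k ω v, dist (x k ω) (x k v) ≤ A₀ * r ^ k →
      ∃ ω' v', π k ω' = ω ∧ π k v' = v ∧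
        dist (x (k + 1) ω') (x (k + 1) v') ≤ A₀ * r ^ (k + 1))
    {k : ℤ} {ω v : Ω k} (h : dist (x k ω) (x k v) ≤ A₀ * r ^ k) :
    (closure (threadCube f k ω) ∩ closure (threadCube f k v)).Nonempty := by
  -- Bundling the level with the pair makes passage to neighbouring children a self-map, which can
  -- be iterated.
  let T := Σ k : ℤ, {e : Ω k × Ω k // dist (x k e.1) (x k e.2) ≤ A₀ * r ^ k}
  have hnext : ∀ t : T, ∃ e : {e : Ω (t.1 + 1) × Ω (t.1 + 1) //
      dist (x (t.1 + 1) e.1) (x (t.1 + 1) e.2) ≤ A₀ * r ^ (t.1 + 1)},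
      π t.1 e.1.1 = t.2.1.1 ∧ π t.1 e.1.2 = t.2.1.2 := by
    rintro ⟨k, ⟨ω, v⟩, h⟩
    obtain ⟨ω', v', h1, h2, h3⟩ := hchild k ω v h
    exact ⟨⟨(ω', v'), h3⟩, h1, h2⟩
  choose next hnext₁ hnext₂ using hnext
  let u : ℕ → T := fun n => (fun t : T => (⟨t.1 + 1, next t⟩ : T))^[n] ⟨k, (ω, v), h⟩
  have hu : ∀ n, u (n + 1) = ⟨(u n).1 + 1, next (u n)⟩ := fun n =>
    Function.iterate_succ_apply' _ _ _
  have hlev : ∀ n : ℕ, (u n).1 = k + n := by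
    intro n
    induction n with
    | zero => simp [u]
    | succ n ih => 
      have h1 : (u (n + 1)).1 = (u n).1 + 1 := congrArg Sigma.fst (hu n)
      rw [h1, ih]
      push_cast
      ring
  have hpow : ∀ n : ℕ, r ^ (u n).1 = r ^ k * r ^ n := fun n => by
    rw [hlev, zpow_add₀ hr.ne', zpow_natCast]
  have hsub : ∀ n, threadCube f (u n).1 (u n).2.1.1 ⊆ threadCube f k ω ∧
      threadCube f (u n).1 (u n).2.1.2 ⊆ threadCube f k v := by
    intro n
    induction n with
    | zero => exact ⟨Subset.rfl, Subset.rfl⟩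
    | succ n ih =>
      rw [hu]
      refine ⟨Subset.trans ?_ ih.1, Subset.trans ?_ ih.2⟩
      · exact hnext₁ (u n) ▸ threadCube_subset_parent hf (u n).1 (next (u n)).1.1
      · exact hnext₂ (u n) ▸ threadCube_subset_parent hf (u n).1 (next (u n)).1.2
  let a : ℕ → X := fun n => x (u n).1 (u n).2.1.1
  let b : ℕ → X := fun n => x (u n).1 (u n).2.1.2
  have ha : CauchySeq a := by
    refine cauchySeq_of_le_geometric r (A * r ^ k) hr1 fun n => ?_
    have h1 := hparent (u n).1 (next (u n)).1.1
    rw [hnext₁, dist_comm] at h1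
    have h2 : a (n + 1) = x ((u n).1 + 1) (next (u n)).1.1 :=
      congrArg (fun t : T => x t.1 t.2.1.1) (hu n)
    rw [h2, mul_assoc, ← hpow]
    exact h1
  obtain ⟨p, hp⟩ := cauchySeq_tendsto_of_complete ha
  have hab : Tendsto (fun n => dist (a n) (b n)) atTop (𝓝 0) := by
    refine squeeze_zero (g := fun n => A₀ * r ^ k * r ^ n) (fun _ => dist_nonneg) (fun n => ?_) ?_
    · rw [mul_assoc, ← hpow]
      exact (u n).2.2
    · simpa using (tendsto_pow_atTop_nhds_zero_of_lt_one hr.le hr1).const_mul (A₀ * r ^ k)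
  have hb : Tendsto b atTop (𝓝 p) := (tendsto_iff_of_dist hab).1 hp
  exact ⟨p, mem_closure_of_tendsto hp (Eventually.of_forall fun n => (hsub n).1 (hmem _ _)),
    mem_closure_of_tendsto hb (Eventually.of_forall fun n => (hsub n).2 (hmem _ _))⟩

/-- Cubes are regular, if they are uniformly fat around their centres. -/
theorem threadCube_subset_closure_familyCore (hr : 0 < r) (hr1 : r < 1) {a : ℝ} (ha : 0 < a)
    (hf : ∀ p k, π k (f p (k + 1)) = f p k)
    (hlf : ∀ k, LocallyFinite (threadCube f k))
    (hdist : ∀ p k, dist p (x k (f p k)) ≤ A * r ^ k)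
    (hball : ∀ k ω, ball (x k ω) (a * r ^ k) ⊆ threadCube f k ω) (k : ℤ) (ω : Ω k) :
    threadCube f k ω ⊆ closure (familyCore (threadCube f k) ω) := by
  have hcentre : ∀ k ω, x k ω ∈ familyCore (threadCube f k) ω := by
    intro k ω
    rw [mem_familyCore]
    intro v hv hmem
    obtain ⟨q, hq, hq'⟩ := mem_closure_iff.1 hmem _ isOpen_ball
      (mem_ball_self (by positivity : 0 < a * r ^ k))
    exact hv ((mem_threadCube.1 hq').symm.trans (mem_threadCube.1 (hball k ω hq)))
  rintro p rfl
  -- The finer centres on the thread of `p` tend to `p`, and cores shrink along a thread.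
  have hlim : Tendsto (fun n : ℕ => x (k + n) (f p (k + n))) atTop (𝓝 p) := by
    rw [tendsto_iff_dist_tendsto_zero]
    refine squeeze_zero (g := fun n => A * r ^ k * r ^ n) (fun _ => dist_nonneg) (fun n => ?_) ?_
    · have := hdist p (k + n)
      rwa [zpow_add₀ hr.ne', zpow_natCast, ← mul_assoc, dist_comm] at this
    · simpa using (tendsto_pow_atTop_nhds_zero_of_lt_one hr.le hr1).const_mul (A * r ^ k)
  exact mem_closure_of_tendsto hlim (Eventually.of_forall fun n =>
    familyCore_threadCube_antitone hf hlf p (by omega) (hcentre _ _))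

end Cubes

/-! ### Assembly and choice of constants -/

theorem mainTheorem1 {X : Type*} [MetricSpace X] [CompleteSpace X]
    (hdoubling : IsDoublingSpace X) (hperfect : IsUniformlyPerfectSpace X)
    (c C : ℝ) (hc : 0 < c) (hcC : c < C) :
    ∃ C₁ C₂ C₃ r₀ : ℝ, 0 < C₁ ∧ 0 < C₂ ∧ 0 < C₃ ∧ 0 < r₀ ∧
      ∀ (r : ℝ), 0 < r → r ≤ r₀ →
      ∀ (Ω : ℤ → Type*) (x : ∀ k : ℤ, Ω k → X),
        (∀ (k : ℤ) (ω v : Ω k), ω ≠ v → c * r ^ k ≤ dist (x k ω) (x k v)) →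
        (∀ (k : ℤ) (y : X), ∃ ω : Ω k, dist y (x k ω) < C * r ^ k) →
        ∃ Q : ∀ k : ℤ, Ω k → Set X,
          -- the cubes of each level cover the space
          (∀ k : ℤ, (⋃ ω : Ω k, Q k ω) = Set.univ) ∧
          -- regularity of the cubes
          (∀ (k : ℤ) (ω : Ω k),
            interior (Q k ω) = interior (closure (Q k ω)) ∧
            closure (interior (Q k ω)) = closure (Q k ω)) ∧
          -- nestedness
          (∀ (k l : ℤ), k ≤ l → ∀ (ω : Ω l) (v : Ω k),
            Q l ω ⊆ Q k v ∨ Q l ω ∩ Q k v = ∅) ∧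
          -- comparison with balls
          (∀ (k : ℤ) (ω : Ω k),
            Metric.ball (x k ω) (C₁ * r ^ k) ⊆ Q k ω ∧
            Q k ω ⊆ Metric.ball (x k ω) (C₂ * r ^ k)) ∧
          -- close points are joined by a chain of three closed cubes
          (∀ (k : ℤ) (y z : X), dist y z ≤ C₃ * r ^ k →
            ∃ ω₀ ω₁ ω₂ : Ω k,
              (closure (Q k ω₀) ∩ closure (Q k ω₁)).Nonempty ∧
              (closure (Q k ω₁) ∩ closure (Q k ω₂)).Nonempty ∧
              y ∈ closure (Q k ω₀) ∧ z ∈ closure (Q k ω₂)) := by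
  obtain ⟨γ, hγ, hperf⟩ := hperfect
  have hC : 0 < C := hc.trans hcC
  obtain ⟨M, hM⟩ := hdoubling.exists_numbering hc ((γ + 2) * C)
  set a := annulusRadius c γ M with ha_def
  have ha : 0 < a := annulusRadius_pos hc hγ M
  have hac : a ≤ c / 8 := annulusRadius_le hc hγ M
  set B := (γ + 3) * C with hB
  have hCB : 4 * C ≤ B := by nlinarith
  have hB0 : 0 < B := by linarith
  -- `B` bounds the parent displacement. The choice of `r₀` brings the level `k + 1` centre of a
  -- thread within `a / 4 * r ^ k` of its point. Then `a / 4 + a / 4` is the radius `a / 2` on which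
  -- parents are forced, and `c / 8 + 2 * (a / 4) ≤ c / 4`.
  refine ⟨a / 4, 3 * B, c / 8, a / (8 * B), by positivity, by positivity, by positivity,
    by positivity, fun r hr hr0 Ω x hsep hden => ?_⟩
  have hrB : r * B ≤ a / 8 := by
    rw [le_div_iff₀ (by positivity)] at hr0
    linarith
  have hr2 : r < 1 / 2 := by nlinarith
  have hpow : ∀ k : ℤ, 0 < r ^ k := fun k => zpow_pos hr k
  have hsucc : ∀ k : ℤ, r ^ (k + 1) = r ^ k * r := fun k => zpow_add_one₀ hr.ne' k
  have hparent : ∀ k : ℤ, ∃ π : Ω (k + 1) → Ω k,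
      (∀ h, dist (x (k + 1) h) (x k (π h)) ≤ B * r ^ k) ∧
      (∀ h ω, dist (x (k + 1) h) (x k ω) ≤ a / 2 * r ^ k → π h = ω) ∧
      (∀ ω v, dist (x k ω) (x k v) ≤ (γ + 2) * C * r ^ k →
        ∃ h h', π h = ω ∧ π h' = v ∧
          dist (x (k + 1) h) (x (k + 1) h') ≤ (γ + 2) * C * r ^ (k + 1)) ∧
      (∀ h h', dist (x (k + 1) h) (x (k + 1) h') ≤ c / 4 * r ^ k →
        ∃ ω, dist (x k (π h)) (x k ω) ≤ (γ + 2) * C * r ^ k ∧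
          dist (x k ω) (x k (π h')) ≤ (γ + 2) * C * r ^ k) := by
    intro k
    have hk := hpow k
    have h1 : (γ + 3) * (C * r ^ (k + 1)) ≤ annulusRadius (c * r ^ k) γ M / 8 := by
      rw [annulusRadius_mul, ← ha_def, hsucc]
      calc (γ + 3) * (C * (r ^ k * r)) = r * B * r ^ k := by rw [hB]; ring
        _ ≤ a / 8 * r ^ k := by gcongr
        _ = a * r ^ k / 8 := by ring
    have h2 : ∀ ω, ∃ j : Ω k → ℕ,
        (∀ v, dist (x k ω) (x k v) ≤ (γ + 2) * (C * r ^ k) → j v < M) ∧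
        InjOn j {v | dist (x k ω) (x k v) ≤ (γ + 2) * (C * r ^ k)} := by
      intro ω
      simpa only [mul_assoc] using hM (r ^ k) hk (Ω k) (x k) (hsep k) (x k ω)
    obtain ⟨π, p1, p2, p3, p4⟩ := exists_parent hγ hperf (mul_pos hc hk)
      (mul_lt_mul_of_pos_right hcC hk) (mul_pos hC (hpow (k + 1))) (hsep k) (hden k)
      (hden (k + 1)) h2 h1
    refine ⟨π, ?_, ?_, ?_, ?_⟩
    · simpa only [hB, mul_assoc] using p1
    · intro h ω hω
      refine p2 h ω (hω.trans_eq ?_)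
      rw [annulusRadius_mul, ← ha_def]
      ring
    · simpa only [mul_assoc] using p3
    · intro h h' hh
      simpa only [mul_assoc] using p4 h h' (hh.trans_eq (by ring))
  choose π hπ₁ hπ₂ hπ₃ hπ₄ using hparent
  have hfinite : ∀ (R : ℝ) (k : ℤ) (p : X), {v | dist p (x k v) ≤ R * r ^ k}.Finite := by
    intro R k p
    obtain ⟨K, hK⟩ := hdoubling.exists_numbering hc R
    obtain ⟨j, hj, hinj⟩ := hK (r ^ k) (hpow k) (Ω k) (x k) (hsep k) p
    refine Finite.of_finite_image ((finite_lt_nat K).subset ?_) hinj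
    rintro _ ⟨v, hv, rfl⟩
    exact hj v hv
  have hthread : ∀ p : X, ∃ f : ∀ k, Ω k, (∀ k, f k ∈ {v | dist p (x k v) ≤ 2 * B * r ^ k}) ∧
      ∀ k, π k (f (k + 1)) = f k := by
    intro p
    refine exists_thread π _ (fun k => hfinite _ k p) (fun k => ?_) fun k h hh => ?_
    · obtain ⟨ω, hω⟩ := hden k p
      have := hpow k
      exact ⟨ω, hω.le.trans (by gcongr; linarith)⟩
    -- The factor `2` reproduces itself: `B + 2 * B * r ≤ 2 * B` because `r < 1 / 2`.
    · have h1 := dist_triangle p (x (k + 1) h) (x k (π k h))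
      have h2 := hπ₁ k h
      have h3 : dist p (x (k + 1) h) ≤ 2 * B * r ^ (k + 1) := hh
      rw [hsucc] at h3
      have h4 : 2 * B * (r ^ k * r) ≤ B * r ^ k := by
        have := mul_pos hB0 (hpow k)
        nlinarith
      change dist p (x k (π k h)) ≤ 2 * B * r ^ k
      linarith
  choose f hdist hf using hthread
  replace hdist : ∀ p k, dist p (x k (f p k)) ≤ 2 * B * r ^ k := hdist
  have hdist' : ∀ p k, dist p (x (k + 1) (f p (k + 1))) ≤ a / 4 * r ^ k := by
    intro p k
    refine (hdist p (k + 1)).trans ?_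
    rw [hsucc]
    have := hpow k
    calc 2 * B * (r ^ k * r) = 2 * (r * B) * r ^ k := by ring
      _ ≤ 2 * (a / 8) * r ^ k := by gcongr
      _ = a / 4 * r ^ k := by ring
  have hlf : ∀ k, LocallyFinite (threadCube f k) := by
    intro k p
    refine ⟨ball p (r ^ k), ball_mem_nhds p (hpow k), (hfinite (2 * B + 1) k p).subset ?_⟩
    rintro _ ⟨q, rfl, hq⟩
    have h1 := dist_triangle_left p (x k (f q k)) q
    have h2 := hdist q k
    rw [mem_ball] at hq
    change dist p (x k (f q k)) ≤ (2 * B + 1) * r ^ k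
    linarith
  have hball : ∀ k ω, ball (x k ω) (a / 4 * r ^ k) ⊆ threadCube f k ω := by
    intro k ω p hp
    rw [mem_ball] at hp
    rw [mem_threadCube, ← hf p k]
    refine hπ₂ k _ ω ?_
    have h1 := dist_triangle_left (x (k + 1) (f p (k + 1))) (x k ω) p
    have h2 := hdist' p k
    linarith
  have htouch : ∀ k (ω v : Ω k), dist (x k ω) (x k v) ≤ (γ + 2) * C * r ^ k →
      (closure (threadCube f k ω) ∩ closure (threadCube f k v)).Nonempty := fun k ω v =>
    closure_threadCube_inter_nonempty hr (by linarith) hf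
      (fun k ω => hball k ω (mem_ball_self (mul_pos (by positivity) (hpow k)))) hπ₁ hπ₃
  refine ⟨threadCube f, iUnion_threadCube, fun k => ?_,
    fun k l hkl ω v => threadCube_nested hf hkl ω v, fun k ω => ⟨hball k ω, ?_⟩,
    fun k y z hyz => ?_⟩
  · exact regular_of_subset_closure_familyCore (hlf k) (iUnion_threadCube k)
      (threadCube_subset_closure_familyCore hr (by linarith) (by positivity : 0 < a / 4) hf hlf
        hdist hball k)
  · rintro p rfl
    rw [mem_ball]
    refine (hdist p k).trans_lt ?_
    have := hpow k
    gcongr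
    linarith
  · obtain ⟨ω, h1, h2⟩ := hπ₄ k (f y (k + 1)) (f z (k + 1)) (by
      have e1 := dist_triangle4 (x (k + 1) (f y (k + 1))) y z (x (k + 1) (f z (k + 1)))
      rw [dist_comm _ y] at e1
      have e2 := hdist' y k
      have e3 := hdist' z k
      have e4 := mul_pos hc (hpow k)
      have e5 : a * r ^ k ≤ c / 8 * r ^ k := mul_le_mul_of_nonneg_right hac (hpow k).le
      linarith)
    rw [hf] at h1 h2
    exact ⟨f y k, ω, f z k, htouch k _ _ h1, htouch k _ _ h2, subset_closure rfl,
      subset_closure rfl⟩
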